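/- Let $D_T = \{x \in \mathbb{R}^2 : |x_1| + |x_2| < 1\}$ be the taxicab Poincaré disk. For a curve $\gamma = (\gamma_1, \gamma_2) : [0,1] \to D_T$ with absolutely continuous components, let $$\operatorname{len}(\gamma) = \int_0^1 \frac{|\gamma_1'(t)| + |\gamma_2'(t)|}{1 - (|\gamma_1(t)| + |\gamma_2(t)|)^2}\, dt,$$ and for $p, q \in D_T$ let $d(p,q)$ be the infimum of $\operatorname{len}(\gamma)$ over all such curves with $\gamma(0) = p$ and $\gamma(1) = q$. For a base point $z$ put $G(x,y;z) = \frac12\,[d(x,z) + d(y,z) - d(x,y)]$. A metric space is called $\delta$-hyperbolic, where $\delta \ge 0$, if for all of its points $x, y, z, w$ $$G(x,y;w) \ge \min\{G(x,z;w),\, G(y,z;w)\} - \delta .$$ Then $d$ is a metric on $D_T$, and $(D_T, d)$ is $\delta$-hyperbolic with $\delta = \ln 3$. The constant is sharp: if $(D_T, d)$ is $\delta$-hyperbolic, then $\delta \ge \ln 3$. -/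

import Mathlib

noncomputable section

/-- The taxicab norm on the plane. -/
def taxicabNorm (v : ℝ × ℝ) : ℝ := |v.1| + |v.2|

/-- The underlying set of the taxicab Poincaré disk: the open unit ball of the taxicab norm.
It is a type of its own, so that it does not inherit a distance from `ℝ × ℝ`. -/
def TaxicabDisk : Type := {x : ℝ × ℝ // taxicabNorm x < 1}

namespace TaxicabDisk

/-- The norm of the tangent vector `v` based at the point `x` of the disk. -/
def tangentNorm (x v : ℝ × ℝ) : ℝ := taxicabNorm v / (1 - taxicabNorm x ^ 2)

/-- The curves from `p` to `q`, parametrized by `[0, 1]`: both components are absolutely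
continuous and the curve stays in the disk. Values outside `[0, 1]` are irrelevant. -/
def curves (p q : TaxicabDisk) : Set (ℝ → ℝ × ℝ) :=
  {γ | AbsolutelyContinuousOnInterval (fun t => (γ t).1) 0 1 ∧
    AbsolutelyContinuousOnInterval (fun t => (γ t).2) 0 1 ∧
    (∀ t ∈ Set.Icc (0 : ℝ) 1, taxicabNorm (γ t) < 1) ∧
    γ 0 = p.1 ∧ γ 1 = q.1}

/-- The length of a curve parametrized by `[0, 1]`. The components of an absolutely continuous
curve are differentiable almost everywhere on `[0, 1]`. -/
def curveLength (γ : ℝ → ℝ × ℝ) : ℝ :=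
  ∫ t in (0 : ℝ)..1,
    tangentNorm (γ t) (deriv (fun s => (γ s).1) t, deriv (fun s => (γ s).2) t)

/-- The distance arising from the length functional. -/
def pathDist (p q : TaxicabDisk) : ℝ := sInf (curveLength '' curves p q)

end TaxicabDisk

/-- The Gromov product of `x` and `y` with base point `z`. -/
def gromovProduct {X : Type*} [MetricSpace X] (x y z : X) : ℝ :=
  (dist x z + dist y z - dist x y) / 2

/-- The four-point condition: the metric space `X` is `δ`-hyperbolic in the sense of Gromov. -/
def IsGromovHyperbolic (X : Type*) [MetricSpace X] (δ : ℝ) : Prop :=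
  0 ≤ δ ∧ ∀ x y z w : X,
    gromovProduct x y w ≥ min (gromovProduct x z w) (gromovProduct y z w) - δ

end

noncomputable section

open Real Set Filter Topology MeasureTheory

/-! ### The inverse hyperbolic tangent on `[0, 1)` -/

theorem two_mul_artanh {x : ℝ} (hx : x ∈ Ioo (-1 : ℝ) 1) :
    2 * artanh x = log (1 + x) - log (1 - x) := by
  rw [artanh_eq_half_log (Ioo_subset_Icc_self hx),
    log_div (by linarith [hx.1]) (by linarith [hx.2])]
  ring

theorem hasDerivAt_artanh {x : ℝ} (hx : x ∈ Ioo (-1 : ℝ) 1) :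
    HasDerivAt artanh (1 / (1 - x ^ 2)) x := by
  have h1 : (1 : ℝ) + x ≠ 0 := by linarith [hx.1]
  have h2 : (1 : ℝ) - x ≠ 0 := by linarith [hx.2]
  have h3 : 1 - x ^ 2 ≠ 0 := by
    rw [show 1 - x ^ 2 = (1 + x) * (1 - x) by ring]
    exact mul_ne_zero h1 h2
  have key : HasDerivAt (fun y => (log (1 + y) - log (1 - y)) / 2) (1 / (1 - x ^ 2)) x := by
    have h := ((((hasDerivAt_id x).const_add 1).log h1).sub
      (((hasDerivAt_id x).const_sub 1).log h2)).div_const 2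
    refine HasDerivAt.congr_deriv h ?_
    change (1 / (1 + x) - -1 / (1 - x)) / 2 = _
    field_simp
    ring
  refine key.congr_of_eventuallyEq ?_
  filter_upwards [Ioo_mem_nhds hx.1 hx.2] with y hy
  rw [← two_mul_artanh hy]
  ring

/-- The mean value estimate for `artanh`. -/
theorem artanh_sub_artanh_le {a b R : ℝ} (ha : 0 ≤ a) (hab : a ≤ b) (hbR : b ≤ R) (hR : R < 1) :
    artanh b - artanh a ≤ (b - a) / (1 - R ^ 2) := by
  have hd : ∀ x ∈ Icc 0 R, HasDerivAt artanh (1 / (1 - x ^ 2)) x := fun x hx =>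
    hasDerivAt_artanh ⟨by linarith [hx.1], by linarith [hx.2]⟩
  have := (convex_Icc 0 R).image_sub_le_mul_sub_of_deriv_le (f := artanh) (C := 1 / (1 - R ^ 2))
    (fun x hx => (hd x hx).continuousAt.continuousWithinAt)
    (fun x hx => (hd x (interior_subset hx)).differentiableAt.differentiableWithinAt)
    (fun x hx => by
      have hx := interior_subset hx
      rw [(hd x hx).deriv]
      have : 0 < 1 - R ^ 2 := by nlinarith [hx.1, hx.2]
      exact one_div_le_one_div_of_le this (by nlinarith [hx.1, hx.2]))
    a ⟨ha, hab.trans hbR⟩ b ⟨ha.trans hab, hbR⟩ hab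
  rwa [one_div_mul_eq_div] at this

/-- A majorization inequality expressing the convexity of `artanh` on `[0, 1)`. -/
theorem artanh_add_artanh_le {u v q w : ℝ} (hu : 0 ≤ u) (hv : 0 ≤ v) (huq : u ≤ q) (hvq : v ≤ q)
    (hq : q < 1) (hw : 0 ≤ w) (hw1 : w < 1) (h : u + v ≤ q + w) :
    artanh u + artanh v ≤ artanh q + artanh w := by
  have e : ∀ {a b : ℝ}, 0 ≤ a → a < 1 → 0 ≤ b → b < 1 →
      2 * (artanh a + artanh b) = log (((1 + a) * (1 + b)) / ((1 - a) * (1 - b))) := by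
    intro a b ha ha1 hb hb1
    have h1 : 1 - a ≠ 0 := by linarith
    have h2 : 1 - b ≠ 0 := by linarith
    have h3 : 1 + a ≠ 0 := by linarith
    have h4 : 1 + b ≠ 0 := by linarith
    rw [log_div (mul_ne_zero h3 h4) (mul_ne_zero h1 h2), log_mul h3 h4, log_mul h1 h2, mul_add,
      two_mul_artanh ⟨by linarith, ha1⟩, two_mul_artanh ⟨by linarith, hb1⟩]
    ring
  have hu1 : 0 < 1 - u := by linarith
  have hv1 : 0 < 1 - v := by linarith
  have hq1 : 0 < 1 - q := by linarith
  have hw2 : 0 < 1 - w := by linarith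
  have hq0 : 0 ≤ q := hu.trans huq
  suffices 2 * (artanh u + artanh v) ≤ 2 * (artanh q + artanh w) by linarith
  rw [e hu (by linarith) hv (by linarith), e hq0 hq hw hw1]
  refine log_le_log (by positivity) ?_
  rw [div_le_div_iff₀ (by positivity) (by positivity)]
  have h1 : 0 ≤ u * v - q * (u + v - q) := by
    nlinarith [mul_nonneg (sub_nonneg.2 huq) (sub_nonneg.2 hvq)]
  have h2 : 0 ≤ 1 + u * v - (u + v) * q := by nlinarith
  have h3 : 0 ≤ (q + w - (u + v)) * (1 + u * v - (u + v) * q) :=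
    mul_nonneg (by linarith) h2
  have h4 : 0 ≤ (u + v) * (u * v - q * (u + v - q)) := mul_nonneg (by linarith) h1
  nlinarith

theorem artanh_midpoint_le {s : ℝ} (hs : 0 ≤ s) (hs1 : s < 1) :
    artanh ((1 + s) / 2) ≤ artanh s + log 3 / 2 := by
  have h1 : (0 : ℝ) < 1 - s := by linarith
  suffices 2 * artanh ((1 + s) / 2) ≤ 2 * artanh s + log 3 by linarith
  rw [two_mul_artanh ⟨by linarith, by linarith⟩, two_mul_artanh ⟨by linarith, hs1⟩,
    show 1 + (1 + s) / 2 = (3 + s) / 2 by ring, show 1 - (1 + s) / 2 = (1 - s) / 2 by ring,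
    log_div (by linarith) two_ne_zero, log_div h1.ne' two_ne_zero]
  have : log (3 + s) ≤ log (1 + s) + log 3 := by
    rw [← log_mul (by linarith) three_ne_zero]
    exact log_le_log (by linarith) (by linarith)
  linarith

/-! ### The taxicab norm and its Gromov product at the origin -/

theorem taxicabNorm_nonneg (x : ℝ × ℝ) : 0 ≤ taxicabNorm x := by
  unfold taxicabNorm
  positivity

theorem taxicabNorm_sub_comm (x y : ℝ × ℝ) : taxicabNorm (x - y) = taxicabNorm (y - x) := by
  simp only [taxicabNorm, Prod.fst_sub, Prod.snd_sub, abs_sub_comm]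

theorem taxicabNorm_sub_le (x y z : ℝ × ℝ) :
    taxicabNorm (x - z) ≤ taxicabNorm (x - y) + taxicabNorm (y - z) := by
  simp only [taxicabNorm, Prod.fst_sub, Prod.snd_sub]
  linarith [abs_sub_le x.1 y.1 z.1, abs_sub_le x.2 y.2 z.2]

theorem eq_of_taxicabNorm_sub_eq_zero {x y : ℝ × ℝ} (h : taxicabNorm (x - y) = 0) : x = y := by
  simp only [taxicabNorm, Prod.fst_sub, Prod.snd_sub] at h
  have h1 := abs_nonneg (x.1 - y.1)
  have h2 := abs_nonneg (x.2 - y.2)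
  ext
  · exact sub_eq_zero.1 (abs_eq_zero.1 (by linarith))
  · exact sub_eq_zero.1 (abs_eq_zero.1 (by linarith))

theorem continuous_taxicabNorm : Continuous taxicabNorm := by
  unfold taxicabNorm
  fun_prop

/-- The Gromov product of two reals with respect to the base point `0`. -/
def realOverlap (a b : ℝ) : ℝ := (|a| + |b| - |a - b|) / 2

/-- The Gromov product, in the taxicab plane, of two points with respect to the origin. -/
def overlap (x y : ℝ × ℝ) : ℝ := (taxicabNorm x + taxicabNorm y - taxicabNorm (x - y)) / 2

theorem overlap_eq_add (x y : ℝ × ℝ) :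
    overlap x y = realOverlap x.1 y.1 + realOverlap x.2 y.2 := by
  simp only [overlap, realOverlap, taxicabNorm, Prod.fst_sub, Prod.snd_sub]
  ring

theorem realOverlap_comm (a b : ℝ) : realOverlap a b = realOverlap b a := by
  simp only [realOverlap, abs_sub_comm a b]
  ring

theorem realOverlap_nonneg (a b : ℝ) : 0 ≤ realOverlap a b := by
  have := abs_sub a b
  unfold realOverlap
  linarith

theorem realOverlap_le_right (a b : ℝ) : realOverlap a b ≤ |b| := by
  have := abs_sub_abs_le_abs_sub a b
  unfold realOverlap
  linarith

/-- The real line is `0`-hyperbolic. -/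
theorem min_realOverlap_le (a b c : ℝ) :
    min (realOverlap a c) (realOverlap b c) ≤ realOverlap a b := by
  rw [min_le_iff]
  unfold realOverlap
  grind

theorem overlap_comm (x y : ℝ × ℝ) : overlap x y = overlap y x := by
  rw [overlap_eq_add, overlap_eq_add, realOverlap_comm, realOverlap_comm x.2]

theorem overlap_self (x : ℝ × ℝ) : overlap x x = taxicabNorm x := by
  simp [overlap, taxicabNorm]

theorem overlap_nonneg (x y : ℝ × ℝ) : 0 ≤ overlap x y := by
  rw [overlap_eq_add]
  exact add_nonneg (realOverlap_nonneg _ _) (realOverlap_nonneg _ _)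

theorem overlap_le_right (x y : ℝ × ℝ) : overlap x y ≤ taxicabNorm y := by
  rw [overlap_eq_add]
  exact add_le_add (realOverlap_le_right _ _) (realOverlap_le_right _ _)

theorem overlap_le_left (x y : ℝ × ℝ) : overlap x y ≤ taxicabNorm x := by
  rw [overlap_comm]
  exact overlap_le_right y x

theorem overlap_add_overlap_le (x y z : ℝ × ℝ) :
    overlap x y + overlap y z ≤ taxicabNorm y + overlap x z := by
  have := taxicabNorm_sub_le x y z
  unfold overlap
  linarith

/-- The three-point estimate for the taxicab Gromov product inside the unit disk. -/
theorem min_overlap_le (x y z : ℝ × ℝ) (hz : taxicabNorm z < 1) :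
    min (overlap x z) (overlap y z) ≤ (1 + overlap x y) / 2 := by
  have h1 := min_realOverlap_le x.1 y.1 z.1
  have h2 := min_realOverlap_le x.2 y.2 z.2
  have h3 := realOverlap_le_right x.1 z.1
  have h4 := realOverlap_le_right y.1 z.1
  have h5 := realOverlap_le_right x.2 z.2
  have h6 := realOverlap_le_right y.2 z.2
  have h7 := realOverlap_nonneg x.1 y.1
  have h8 := realOverlap_nonneg x.2 y.2
  have h9 : |z.1| + |z.2| < 1 := hz
  rw [overlap_eq_add, overlap_eq_add, overlap_eq_add, min_le_iff]
  by_contra! h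
  rcases min_le_iff.1 h1 with h1 | h1 <;> rcases min_le_iff.1 h2 with h2 | h2 <;>
    linarith

/-- Every pair of reals has a median with the origin. -/
theorem exists_real_median (a b : ℝ) :
    ∃ m, |m| = realOverlap a b ∧ (∀ t ∈ Icc (0 : ℝ) 1, |m + t * (a - m)| = |m| + t * |a - m|) ∧
      ∀ t ∈ Icc (0 : ℝ) 1, |m + t * (b - m)| = |m| + t * |b - m| := by
  have key : ∀ {m c : ℝ}, 0 ≤ m * (c - m) → ∀ t ∈ Icc (0 : ℝ) 1,
      |m + t * (c - m)| = |m| + t * |c - m| := by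
    intro m c h t ht
    rw [abs_add_eq_add_abs_iff _ _ |>.2, abs_mul, abs_of_nonneg ht.1]
    rcases mul_nonneg_iff.1 h with h | h
    · exact Or.inl ⟨h.1, mul_nonneg ht.1 h.2⟩
    · exact Or.inr ⟨h.1, mul_nonpos_of_nonneg_of_nonpos ht.1 h.2⟩
  have main : ∃ m, |m| = realOverlap a b ∧ 0 ≤ m * (a - m) ∧ 0 ≤ m * (b - m) := by
    unfold realOverlap
    rcases le_total 0 a with ha | ha <;> rcases le_total 0 b with hb | hb
    · refine ⟨min a b, ?_, mul_nonneg (le_min ha hb) (by simp),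
        mul_nonneg (le_min ha hb) (by simp)⟩
      grind
    · exact ⟨0, by grind, by simp, by simp⟩
    · exact ⟨0, by grind, by simp, by simp⟩
    · refine ⟨max a b, ?_, mul_nonneg_of_nonpos_of_nonpos (max_le ha hb) (by simp),
        mul_nonneg_of_nonpos_of_nonpos (max_le ha hb) (by simp)⟩
      grind
  obtain ⟨m, h, h1, h2⟩ := main
  exact ⟨m, h, key h1, key h2⟩

/-- Every pair of points of the taxicab plane has a median with the origin, and the taxicab norm is
affine on the segments from the median to the two points. -/
theorem exists_median (x y : ℝ × ℝ) :
    ∃ m, taxicabNorm m = overlap x y ∧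
      (∀ t ∈ Icc (0 : ℝ) 1, taxicabNorm (m + t • (x - m)) =
        taxicabNorm m + t * taxicabNorm (x - m)) ∧
      ∀ t ∈ Icc (0 : ℝ) 1, taxicabNorm (m + t • (y - m)) =
        taxicabNorm m + t * taxicabNorm (y - m) := by
  obtain ⟨m, h, hx, hy⟩ := exists_real_median x.1 y.1
  obtain ⟨n, h', hx', hy'⟩ := exists_real_median x.2 y.2
  refine ⟨(m, n), ?_, fun t ht => ?_, fun t ht => ?_⟩
  · rw [overlap_eq_add, ← h, ← h', taxicabNorm]
  · simp only [taxicabNorm, Prod.fst_add, Prod.snd_add, Prod.smul_fst, Prod.smul_snd, Prod.fst_sub,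
      Prod.snd_sub, smul_eq_mul, hx t ht, hx' t ht]
    ring
  · simp only [taxicabNorm, Prod.fst_add, Prod.snd_add, Prod.smul_fst, Prod.smul_snd, Prod.fst_sub,
      Prod.snd_sub, smul_eq_mul, hy t ht, hy' t ht]
    ring

/-! ### The explicit distance -/

/-- The closed form of the distance of the taxicab Poincaré disk. -/
def explicitDist (x y : ℝ × ℝ) : ℝ :=
  artanh (taxicabNorm x) + artanh (taxicabNorm y) - 2 * artanh (overlap x y)

theorem explicitDist_self (x : ℝ × ℝ) : explicitDist x x = 0 := by
  rw [explicitDist, overlap_self]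
  ring

theorem explicitDist_comm (x y : ℝ × ℝ) : explicitDist x y = explicitDist y x := by
  rw [explicitDist, explicitDist, overlap_comm]
  ring

theorem explicitDist_triangle {x y z : ℝ × ℝ} (hx : taxicabNorm x < 1) (hy : taxicabNorm y < 1) :
    explicitDist x z ≤ explicitDist x y + explicitDist y z := by
  have := artanh_add_artanh_le (overlap_nonneg x y) (overlap_nonneg y z) (overlap_le_right x y)
    (overlap_le_left y z) hy (overlap_nonneg x z) ((overlap_le_left x z).trans_lt hx)
    (overlap_add_overlap_le x y z)
  unfold explicitDist
  linarith

theorem artanh_overlap_le_left {x y : ℝ × ℝ} (hx : taxicabNorm x < 1) :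
    artanh (overlap x y) ≤ artanh (taxicabNorm x) :=
  artanh_le_artanh (by linarith [overlap_nonneg x y]) hx (overlap_le_left x y)

theorem artanh_overlap_le_right {x y : ℝ × ℝ} (hy : taxicabNorm y < 1) :
    artanh (overlap x y) ≤ artanh (taxicabNorm y) :=
  artanh_le_artanh (by linarith [overlap_nonneg x y]) hy (overlap_le_right x y)

theorem eq_of_explicitDist_eq_zero {x y : ℝ × ℝ} (hx : taxicabNorm x < 1)
    (hy : taxicabNorm y < 1) (h : explicitDist x y = 0) : x = y := by
  have h1 := artanh_overlap_le_left (y := y) hx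
  have h2 := artanh_overlap_le_right (x := x) hy
  unfold explicitDist at h
  have h0 := overlap_nonneg x y
  have hN := overlap_le_left x y
  have hN' := overlap_le_right x y
  have e1 := artanh_injOn ⟨by linarith, by linarith⟩ ⟨by linarith, hx⟩
    (show artanh (overlap x y) = artanh (taxicabNorm x) by linarith)
  have e2 := artanh_injOn ⟨by linarith, by linarith⟩ ⟨by linarith, hy⟩
    (show artanh (overlap x y) = artanh (taxicabNorm y) by linarith)
  refine eq_of_taxicabNorm_sub_eq_zero ?_
  unfold overlap at e1 e2
  linarith

/-- Comparison of the explicit distance with the taxicab distance. -/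
theorem explicitDist_le {x y : ℝ × ℝ} {R : ℝ} (hx : taxicabNorm x ≤ R) (hy : taxicabNorm y ≤ R)
    (hR : R < 1) : explicitDist x y ≤ taxicabNorm (x - y) / (1 - R ^ 2) := by
  have h1 := artanh_sub_artanh_le (overlap_nonneg x y) (overlap_le_left x y) hx hR
  have h2 := artanh_sub_artanh_le (overlap_nonneg x y) (overlap_le_right x y) hy hR
  have h3 : taxicabNorm (x - y) / (1 - R ^ 2) = (taxicabNorm x - overlap x y) / (1 - R ^ 2) +
      (taxicabNorm y - overlap x y) / (1 - R ^ 2) := by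
    rw [← add_div]
    unfold overlap
    ring
  unfold explicitDist
  linarith

/-- A function whose increments are controlled by those of two absolutely continuous functions is
absolutely continuous. -/
theorem AbsolutelyContinuousOnInterval.of_dist_le {f₁ f₂ g : ℝ → ℝ} {a b C : ℝ}
    (h₁ : AbsolutelyContinuousOnInterval f₁ a b) (h₂ : AbsolutelyContinuousOnInterval f₂ a b)
    (h : ∀ s ∈ uIcc a b, ∀ t ∈ uIcc a b,
      dist (g s) (g t) ≤ C * (dist (f₁ s) (f₁ t) + dist (f₂ s) (f₂ t))) :
    AbsolutelyContinuousOnInterval g a b := by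
  have h₁₂ := (Tendsto.add h₁ h₂).const_mul C
  simp only [add_zero, mul_zero] at h₁₂
  refine squeeze_zero' (Eventually.of_forall fun _ => Finset.sum_nonneg fun _ _ => dist_nonneg)
    ?_ h₁₂
  rw [eventually_inf_principal]
  refine Eventually.of_forall fun E hE => ?_
  rw [← Finset.sum_add_distrib, Finset.mul_sum]
  exact Finset.sum_le_sum fun i hi => h _ (hE.1 i hi).1 _ (hE.1 i hi).2

namespace TaxicabDisk

theorem abs_explicitDist_sub_le {p x y : ℝ × ℝ} (hp : taxicabNorm p < 1) (hx : taxicabNorm x < 1)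
    (hy : taxicabNorm y < 1) :
    |explicitDist p y - explicitDist p x| ≤ explicitDist x y := by
  have h1 := explicitDist_triangle (z := y) hp hx
  have h2 := explicitDist_triangle (z := x) hp hy
  rw [explicitDist_comm y x] at h2
  rw [abs_le]
  constructor <;> linarith

/-- The norm of the velocity of a curve in the disk bounds the speed at which the explicit distance
from a point grows along the curve. -/
theorem deriv_explicitDist_le_tangentNorm {p : ℝ × ℝ} (hp : taxicabNorm p < 1)
    {γ : ℝ → ℝ × ℝ} {t : ℝ} (h1 : DifferentiableAt ℝ (fun s => (γ s).1) t)
    (h2 : DifferentiableAt ℝ (fun s => (γ s).2) t) (hγ : taxicabNorm (γ t) < 1)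
    (hg : DifferentiableAt ℝ (fun s => explicitDist p (γ s)) t) :
    deriv (fun s => explicitDist p (γ s)) t ≤
      tangentNorm (γ t) (deriv (fun s => (γ s).1) t, deriv (fun s => (γ s).2) t) := by
  have hc : ContinuousAt γ t := h1.continuousAt.prodMk h2.continuousAt
  have hN : ContinuousAt (fun s => taxicabNorm (γ s)) t :=
    continuous_taxicabNorm.continuousAt.comp hc
  have hmono : 𝓝[>] t ≤ 𝓝[≠] t := nhdsWithin_mono _ fun s hs => (ne_of_gt hs)
  have l1 := hg.hasDerivAt.tendsto_slope.mono_left hmono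
  have s1 := h1.hasDerivAt.tendsto_slope.mono_left hmono
  have s2 := h2.hasDerivAt.tendsto_slope.mono_left hmono
  have hmax : Tendsto (fun s => max (taxicabNorm (γ t)) (taxicabNorm (γ s))) (𝓝[>] t)
      (𝓝 (taxicabNorm (γ t))) := by
    have := (tendsto_const_nhds (x := taxicabNorm (γ t))).max
      (hN.tendsto.mono_left (nhdsWithin_le_nhds (s := Ioi t)))
    rwa [max_self] at this
  have hpos : 1 - taxicabNorm (γ t) ^ 2 ≠ 0 := by nlinarith [taxicabNorm_nonneg (γ t)]
  have l2 := (s1.abs.add s2.abs).div (tendsto_const_nhds.sub (hmax.pow 2)) hpos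
  refine le_of_tendsto_of_tendsto l1 l2 ?_
  have hlt : ∀ᶠ s in 𝓝[>] t, taxicabNorm (γ s) < 1 :=
    nhdsWithin_le_nhds (hN.eventually (gt_mem_nhds hγ))
  filter_upwards [hlt, self_mem_nhdsWithin] with s hs hst
  have hst : 0 < s - t := sub_pos.2 hst
  have key := (le_abs_self _).trans ((abs_explicitDist_sub_le hp hγ hs).trans
    (explicitDist_le (le_max_left _ (taxicabNorm (γ s))) (le_max_right _ _) (max_lt hγ hs)))
  simp only [slope_def_field, Pi.div_apply]
  rw [abs_div, abs_div, abs_of_pos hst, ← add_div, div_right_comm]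
  refine div_le_div_of_nonneg_right (key.trans_eq ?_) hst.le
  rw [taxicabNorm_sub_comm]
  rfl

theorem explicitDist_le_curveLength {p q : TaxicabDisk} {γ : ℝ → ℝ × ℝ} (hγ : γ ∈ curves p q) :
    explicitDist p.1 q.1 ≤ curveLength γ := by
  obtain ⟨h1, h2, hlt, h0, h1'⟩ := hγ
  have hI : uIcc (0 : ℝ) 1 = Icc 0 1 := uIcc_of_le zero_le_one
  have hcont : ContinuousOn (fun t => taxicabNorm (γ t)) (uIcc 0 1) :=
    (h1.continuousOn.abs).add (h2.continuousOn.abs)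
  obtain ⟨t₀, ht₀, hmax⟩ := isCompact_uIcc.exists_isMaxOn nonempty_uIcc hcont
  have hR : taxicabNorm (γ t₀) < 1 := hlt _ (hI ▸ ht₀)
  have hlt' : ∀ t ∈ uIcc (0 : ℝ) 1, taxicabNorm (γ t) < 1 := fun t ht => hlt t (hI ▸ ht)
  have hg : AbsolutelyContinuousOnInterval (fun t => explicitDist p.1 (γ t)) 0 1 := by
    refine h1.of_dist_le (C := 1 / (1 - taxicabNorm (γ t₀) ^ 2)) h2 fun s hs t ht => ?_
    rw [Real.dist_eq]
    refine (abs_explicitDist_sub_le p.2 (hlt' t ht) (hlt' s hs)).trans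
      ((explicitDist_le (hmax ht) (hmax hs) hR).trans_eq ?_)
    rw [taxicabNorm_sub_comm, one_div_mul_eq_div]
    rfl
  have hend : explicitDist p.1 q.1 =
      ∫ t in (0 : ℝ)..1, deriv (fun t => explicitDist p.1 (γ t)) t := by
    rw [hg.integral_deriv_eq_sub, h0, h1', explicitDist_self, sub_zero]
  rw [hend]
  refine intervalIntegral.integral_mono_ae_restrict zero_le_one hg.intervalIntegrable_deriv ?_ ?_
  · have hd := h1.intervalIntegrable_deriv.abs.add h2.intervalIntegrable_deriv.abs
    refine (hd.mul_continuousOn (g := fun t => (1 - taxicabNorm (γ t) ^ 2)⁻¹) ?_).congr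
      fun t _ => ?_
    · refine (continuousOn_const.sub (hcont.pow 2)).inv₀ fun t ht => ?_
      change 1 - taxicabNorm (γ t) ^ 2 ≠ 0
      nlinarith [taxicabNorm_nonneg (γ t), hlt' t ht]
    · simp only [tangentNorm, div_eq_mul_inv]
      rfl
  · rw [EventuallyLE, ae_restrict_iff' measurableSet_Icc]
    filter_upwards [h1.ae_differentiableAt, h2.ae_differentiableAt, hg.ae_differentiableAt]
      with t ht1 ht2 ht3 ht
    rw [hI] at ht1 ht2 ht3
    exact deriv_explicitDist_le_tangentNorm p.2 (ht1 ht) (ht2 ht) (hlt t ht) (ht3 ht)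

/-- The length of a segment on a line along which the taxicab norm is affine. -/
theorem integral_tangentNorm_segment {γ : ℝ → ℝ × ℝ} {m v : ℝ × ℝ} {a b α β ε : ℝ} (hab : a ≤ b)
    (hγ : ∀ t ∈ Ioo a b, γ t = m + (α + β * t) • v) (hε : ε * β = |β|)
    (hI : ∀ t ∈ Icc a b, α + β * t ∈ Icc (0 : ℝ) 1)
    (hN : ∀ s ∈ Icc (0 : ℝ) 1, taxicabNorm (m + s • v) = taxicabNorm m + s * taxicabNorm v)
    (hlt : taxicabNorm (m + v) < 1) :
    IntervalIntegrable (fun t => tangentNorm (γ t)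
      (deriv (fun s => (γ s).1) t, deriv (fun s => (γ s).2) t)) volume a b ∧
    ∫ t in a..b, tangentNorm (γ t) (deriv (fun s => (γ s).1) t, deriv (fun s => (γ s).2) t) =
      ε * artanh (taxicabNorm m + (α + β * b) * taxicabNorm v) -
        ε * artanh (taxicabNorm m + (α + β * a) * taxicabNorm v) := by
  have hm0 := taxicabNorm_nonneg m
  have hv0 := taxicabNorm_nonneg v
  have h1 := hN 1 (by simp)
  rw [one_smul, one_mul] at h1
  have hmem : ∀ t ∈ Icc a b, taxicabNorm m + (α + β * t) * taxicabNorm v ∈ Ico (0 : ℝ) 1 := by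
    intro t ht
    obtain ⟨h2, h3⟩ := hI t ht
    exact ⟨by positivity, by nlinarith⟩
  have hder : ∀ t ∈ Icc a b,
      HasDerivAt (fun t => ε * artanh (taxicabNorm m + (α + β * t) * taxicabNorm v))
        (|β| * taxicabNorm v / (1 - (taxicabNorm m + (α + β * t) * taxicabNorm v) ^ 2)) t := by
    intro t ht
    obtain ⟨h2, h3⟩ := hmem t ht
    have hlin : HasDerivAt (fun t => taxicabNorm m + (α + β * t) * taxicabNorm v)
        (β * 1 * taxicabNorm v) t :=
      ((((hasDerivAt_id t).const_mul β).const_add α).mul_const _).const_add _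
    refine (((hasDerivAt_artanh ⟨by linarith, h3⟩).comp t hlin).const_mul ε).congr_deriv ?_
    rw [← hε]
    ring
  have hcont : ContinuousOn
      (fun t => ε * artanh (taxicabNorm m + (α + β * t) * taxicabNorm v)) (Icc a b) :=
    fun t ht => (hder t ht).continuousAt.continuousWithinAt
  have heq : ∀ t ∈ Ioo a b,
      tangentNorm (γ t) (deriv (fun s => (γ s).1) t, deriv (fun s => (γ s).2) t) =
        |β| * taxicabNorm v / (1 - (taxicabNorm m + (α + β * t) * taxicabNorm v) ^ 2) := by
    intro t ht
    have hev : ∀ᶠ s in 𝓝 t, γ s = m + (α + β * s) • v := by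
      filter_upwards [Ioo_mem_nhds ht.1 ht.2] with s hs using hγ s hs
    have hd : ∀ c d : ℝ, HasDerivAt (fun s => c + (α + β * s) * d) (β * 1 * d) t := fun c d =>
      ((((hasDerivAt_id t).const_mul β).const_add α).mul_const _).const_add _
    have e1 : deriv (fun s => (γ s).1) t = β * 1 * v.1 := by
      rw [← (hd m.1 v.1).deriv]
      refine EventuallyEq.deriv_eq ?_
      filter_upwards [hev] with s hs
      simp [hs]
    have e2 : deriv (fun s => (γ s).2) t = β * 1 * v.2 := by
      rw [← (hd m.2 v.2).deriv]
      refine EventuallyEq.deriv_eq ?_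
      filter_upwards [hev] with s hs
      simp [hs]
    rw [e1, e2, tangentNorm, hγ t ht, hN _ (hI t (Ioo_subset_Icc_self ht))]
    congr 1
    simp only [taxicabNorm, abs_mul, abs_one]
    ring
  have hder' : ∀ t ∈ Ioo a b,
      HasDerivAt (fun t => ε * artanh (taxicabNorm m + (α + β * t) * taxicabNorm v))
        (tangentNorm (γ t) (deriv (fun s => (γ s).1) t, deriv (fun s => (γ s).2) t)) t := by
    intro t ht
    rw [heq t ht]
    exact hder t (Ioo_subset_Icc_self ht)
  have hint : IntervalIntegrable (fun t => tangentNorm (γ t)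
      (deriv (fun s => (γ s).1) t, deriv (fun s => (γ s).2) t)) volume a b := by
    refine intervalIntegral.intervalIntegrable_deriv_of_nonneg
      (by rwa [uIcc_of_le hab]) (by rwa [min_eq_left hab, max_eq_right hab]) fun t ht => ?_
    rw [min_eq_left hab, max_eq_right hab] at ht
    rw [heq t ht]
    obtain ⟨h2, h3⟩ := hmem t (Ioo_subset_Icc_self ht)
    exact div_nonneg (by positivity) (by nlinarith)
  exact ⟨hint, intervalIntegral.integral_eq_sub_of_hasDerivAt_of_le hab hcont hder' hint⟩

/-- The broken segment from `p` to `q` through `m`, parametrized by `[0, 1]`. -/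
def brokenSegment (p m q : ℝ × ℝ) (t : ℝ) : ℝ × ℝ :=
  m + max (1 - 2 * t) 0 • (p - m) + max (2 * t - 1) 0 • (q - m)

theorem absolutelyContinuousOnInterval_max (c d a b : ℝ) :
    AbsolutelyContinuousOnInterval (fun t => max (c + d * t) 0) a b := by
  refine (LipschitzWith.of_dist_le_mul (K := ‖d‖₊) fun s t => ?_).lipschitzOnWith
    |>.absolutelyContinuousOnInterval
  rw [Real.dist_eq, Real.dist_eq, coe_nnnorm, Real.norm_eq_abs, ← abs_mul]
  refine (abs_max_sub_max_le_abs _ _ _).trans_eq ?_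
  congr 1
  ring

theorem absolutelyContinuousOnInterval_const (c a b : ℝ) :
    AbsolutelyContinuousOnInterval (fun _ => c) a b :=
  (LipschitzWith.const c).lipschitzOnWith.absolutelyContinuousOnInterval

theorem absolutelyContinuousOnInterval_broken (c d e a b : ℝ) :
    AbsolutelyContinuousOnInterval
      (fun t => c + max (1 - 2 * t) 0 * d + max (2 * t - 1) 0 * e) a b := by
  have h1 := absolutelyContinuousOnInterval_max 1 (-2) a b
  have h2 := absolutelyContinuousOnInterval_max (-1) 2 a b
  convert! ((absolutelyContinuousOnInterval_const c a b).add (h1.const_mul d)).add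
    (h2.const_mul e) using 2 with t
  simp only [Pi.add_apply]
  ring_nf

theorem exists_curve_length_eq (p q : TaxicabDisk) :
    ∃ γ ∈ curves p q, curveLength γ = explicitDist p.1 q.1 := by
  obtain ⟨m, hm, hp, hq⟩ := exists_median p.1 q.1
  have hp1 := hp 1 (by simp)
  have hq1 := hq 1 (by simp)
  rw [one_smul, one_mul, add_sub_cancel] at hp1 hq1
  have hpN := p.2
  have hqN := q.2
  have hl : ∀ t ≤ (1 / 2 : ℝ), brokenSegment p.1 m q.1 t = m + (1 + (-2) * t) • (p.1 - m) := by
    intro t ht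
    rw [brokenSegment, max_eq_left (by linarith), max_eq_right (by linarith), zero_smul, add_zero]
    congr 2
    ring
  have hr : ∀ t ≥ (1 / 2 : ℝ), brokenSegment p.1 m q.1 t = m + (-1 + 2 * t) • (q.1 - m) := by
    intro t ht
    rw [brokenSegment, max_eq_right (by linarith), max_eq_left (by linarith), zero_smul, add_zero]
    congr 2
    ring
  have il := integral_tangentNorm_segment (γ := brokenSegment p.1 m q.1) (a := 0) (b := 1 / 2)
    (ε := -1) (by norm_num) (fun t ht => hl t ht.2.le) (by norm_num)
    (fun t ht => ⟨by linarith [ht.2], by linarith [ht.1]⟩) hp (by rw [add_sub_cancel]; exact p.2)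
  have ir := integral_tangentNorm_segment (γ := brokenSegment p.1 m q.1) (a := 1 / 2) (b := 1)
    (ε := 1) (by norm_num) (fun t ht => hr t ht.1.le) (by norm_num)
    (fun t ht => ⟨by linarith [ht.1], by linarith [ht.2]⟩) hq (by rw [add_sub_cancel]; exact q.2)
  refine ⟨brokenSegment p.1 m q.1, ⟨?_, ?_, fun t ht => ?_, ?_, ?_⟩, ?_⟩
  · exact absolutelyContinuousOnInterval_broken _ _ _ _ _
  · exact absolutelyContinuousOnInterval_broken _ _ _ _ _
  · rcases le_total t (1 / 2) with h | h
    · rw [hl t h, hp _ ⟨by linarith, by linarith [ht.1]⟩]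
      nlinarith [taxicabNorm_nonneg (p.1 - m), ht.1]
    · rw [hr t h, hq _ ⟨by linarith, by linarith [ht.2]⟩]
      nlinarith [taxicabNorm_nonneg (q.1 - m), ht.2]
  · rw [hl 0 (by norm_num), mul_zero, add_zero, one_smul, add_sub_cancel]
  · rw [hr 1 (by norm_num), show (-1 + 2 * 1 : ℝ) = 1 by norm_num, one_smul, add_sub_cancel]
  · rw [curveLength, ← intervalIntegral.integral_add_adjacent_intervals il.1 ir.1, il.2, ir.2,
      explicitDist, hp1, hq1, ← hm]
    norm_num
    ring

/-- The distance arising from the length functional has a closed form. -/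
theorem pathDist_eq_explicitDist (p q : TaxicabDisk) : pathDist p q = explicitDist p.1 q.1 := by
  obtain ⟨γ, hγ, h⟩ := exists_curve_length_eq p q
  refine IsLeast.csInf_eq ⟨⟨γ, hγ, h⟩, ?_⟩
  rintro _ ⟨γ', hγ', rfl⟩
  exact explicitDist_le_curveLength hγ'

/-- The metric of the taxicab Poincaré disk. -/
abbrev metricSpace : MetricSpace TaxicabDisk where
  dist := pathDist
  dist_self p := by rw [pathDist_eq_explicitDist, explicitDist_self]
  dist_comm p q := by rw [pathDist_eq_explicitDist, pathDist_eq_explicitDist, explicitDist_comm]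
  dist_triangle p q r := by
    simp only [pathDist_eq_explicitDist]
    exact explicitDist_triangle p.2 q.2
  eq_of_dist_eq_zero {p q} h := by
    rw [pathDist_eq_explicitDist] at h
    exact Subtype.ext (eq_of_explicitDist_eq_zero p.2 q.2 h)

/-- The disk is `log 3 / 2`-hyperbolic with respect to the origin. -/
theorem min_artanh_overlap_le (x y z : TaxicabDisk) :
    min (artanh (overlap x.1 z.1)) (artanh (overlap y.1 z.1)) ≤
      artanh (overlap x.1 y.1) + log 3 / 2 := by
  have h0 := overlap_nonneg x.1 y.1
  have h1 : overlap x.1 y.1 < 1 := (overlap_le_left _ _).trans_lt x.2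
  refine le_trans ?_ (artanh_midpoint_le h0 h1)
  rw [min_le_iff]
  refine (min_le_iff.1 (min_overlap_le x.1 y.1 z.1 z.2)).imp (fun h => ?_) fun h => ?_ <;>
    exact artanh_le_artanh (by linarith [overlap_nonneg x.1 z.1, overlap_nonneg y.1 z.1])
      (by linarith) h

theorem isGromovHyperbolic_log_three : @IsGromovHyperbolic TaxicabDisk metricSpace (log 3) := by
  refine ⟨log_nonneg (by norm_num), fun x y z w => ?_⟩
  let _ := metricSpace
  have hd : ∀ p q : TaxicabDisk, dist p q = explicitDist p.1 q.1 := pathDist_eq_explicitDist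
  have h1 := min_artanh_overlap_le x y z
  have h2 := min_artanh_overlap_le x y w
  have h3 := min_artanh_overlap_le z w x
  have h4 := min_artanh_overlap_le z w y
  simp only [gromovProduct, hd, explicitDist]
  rw [overlap_comm z.1 x.1, overlap_comm w.1 x.1] at h3
  rw [overlap_comm z.1 y.1, overlap_comm w.1 y.1] at h4
  rw [min_le_iff] at h1 h2 h3 h4
  rw [ge_iff_le, sub_le_iff_le_add, min_le_iff]
  by_contra! h
  rcases h1 with h1 | h1 <;> rcases h2 with h2 | h2 <;> rcases h3 with h3 | h3 <;>
    rcases h4 with h4 | h4 <;> linarith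

theorem two_mul_artanh_le_of_isGromovHyperbolic {δ : ℝ}
    (h : @IsGromovHyperbolic TaxicabDisk metricSpace δ) {s : ℝ} (hs : 0 ≤ s) (hs1 : s < 1 / 2) :
    2 * artanh s ≤ δ := by
  let _ := metricSpace
  have hd : ∀ p q : TaxicabDisk, dist p q = explicitDist p.1 q.1 := pathDist_eq_explicitDist
  have key := h.2
  simp only [gromovProduct, hd] at key
  have hN : |s| + |s| < 1 := by rw [abs_of_nonneg hs]; linarith
  have h4 := key ⟨(s, s), hN⟩ ⟨(-s, -s), by simpa [taxicabNorm] using hN⟩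
    ⟨(s, -s), by simpa [taxicabNorm] using hN⟩ ⟨(-s, s), by simpa [taxicabNorm] using hN⟩
  have e0 : realOverlap s s = s := by simp [realOverlap, abs_of_nonneg hs]
  have e1 : realOverlap (-s) (-s) = s := by simp [realOverlap, abs_of_nonneg hs]
  have e2 : realOverlap s (-s) = 0 := by
    rw [realOverlap, sub_neg_eq_add, abs_neg, abs_of_nonneg hs, abs_of_nonneg (by linarith)]
    ring
  have e3 : realOverlap (-s) s = 0 := by rw [realOverlap_comm, e2]
  simp only [explicitDist, overlap_eq_add, e0, e1, e2, e3, taxicabNorm, abs_neg,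
    abs_of_nonneg hs, add_zero, zero_add, artanh_zero, ge_iff_le, sub_le_iff_le_add,
    min_le_iff] at h4
  rcases h4 with h4 | h4 <;> linarith

theorem log_three_le_of_isGromovHyperbolic {δ : ℝ}
    (h : @IsGromovHyperbolic TaxicabDisk metricSpace δ) : log 3 ≤ δ := by
  have hlog : 2 * artanh (1 / 2) = log 3 := by
    rw [two_mul_artanh ⟨by norm_num, by norm_num⟩, ← log_div (by norm_num) (by norm_num)]
    norm_num
  rw [← hlog]
  have hc : Tendsto (fun s => 2 * artanh s) (𝓝[<] (1 / 2)) (𝓝 (2 * artanh (1 / 2))) :=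
    ((hasDerivAt_artanh ⟨by norm_num, by norm_num⟩).continuousAt.tendsto.mono_left
      nhdsWithin_le_nhds).const_mul 2
  refine le_of_tendsto hc ?_
  filter_upwards [Ioo_mem_nhdsLT (show (0 : ℝ) < 1 / 2 by norm_num)] with s hs
  exact two_mul_artanh_le_of_isGromovHyperbolic h hs.1.le hs.2

end TaxicabDisk

end

theorem theoremD :
    ∃ _ : MetricSpace TaxicabDisk,
      (∀ p q : TaxicabDisk, dist p q = TaxicabDisk.pathDist p q) ∧
      IsLeast {δ : ℝ | IsGromovHyperbolic TaxicabDisk δ} (Real.log 3) :=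
  ⟨TaxicabDisk.metricSpace, fun _ _ => rfl, TaxicabDisk.isGromovHyperbolic_log_three,
    fun _ h => TaxicabDisk.log_three_le_of_isGromovHyperbolic h⟩
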